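/- A connected finite simple graph is called antiregular if it has exactly one pair of distinct vertices of equal degree (so it has at least two vertices); these two vertices are its degree-repeating vertices. A terminal vertex is a vertex of degree $1$. Let $G$ be an antiregular graph with vertex set $\{1,\dots,k\}$ and Laplacian matrix $\mathcal L_A^{(k)}$ (degree matrix minus adjacency matrix), and let $n\ge 1$. For each $p\in\{1,\dots,n\}$ choose a terminal vertex $t_p$ of $G$ and a degree-repeating vertex $r_p$ of $G$ with $r_p\neq t_p$. Take $n$ disjoint copies of $G$ and, for each $p\in\{1,\dots,n-1\}$, add one edge joining the vertex $t_p$ of the $p$th copy to the vertex $r_{p+1}$ of the $(p+1)$th copy. Write $e_{(p,v)}$ for the standard basis vector of $\mathbb R^{nk}$ at the vertex $v$ of the $p$th copy, and let $Z$ be the matrix with columns $z_p=e_{(p,t_p)}-e_{(p+1,r_{p+1})}$, $p=1,\dots,n-1$. Then: (1) the Laplacian matrix of the resulting graph is $\mathscr L=I_n\otimes\mathcal L_A^{(k)}+ZZ^T$; (2) the $nk$ eigenvalues of the real symmetric matrix $\mathscr L$, counted with multiplicity, are pairwise distinct; (3) every eigenvector of $\mathscr L$ has a nonzero entry at the vertex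 $r_1$ of the first copy. -/

import Mathlib

open scoped Kronecker

namespace AntiregularChain

/-- An antiregular graph: a connected simple graph with exactly one (unordered) pair of distinct
vertices that have the same degree. -/
def IsAntiregular {k : ℕ} (G : SimpleGraph (Fin k)) [DecidableRel G.Adj] : Prop :=
  G.Connected ∧ ∃ a b : Fin k, a ≠ b ∧ G.degree a = G.degree b ∧
    ∀ u v : Fin k, u ≠ v → G.degree u = G.degree v → (u = a ∧ v = b) ∨ (u = b ∧ v = a)

/-- A terminal vertex: a vertex with exactly one neighbor. -/
def IsTerminal {k : ℕ} (G : SimpleGraph (Fin k)) [DecidableRel G.Adj] (v : Fin k) : Prop :=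
  G.degree v = 1

/-- A degree-repeating vertex: another vertex has the same degree. -/
def IsDegreeRepeating {k : ℕ} (G : SimpleGraph (Fin k)) [DecidableRel G.Adj] (v : Fin k) : Prop :=
  ∃ w : Fin k, w ≠ v ∧ G.degree w = G.degree v

/-- The chain of `n` copies of `G`; vertex `(p, v)` is the vertex `v` of copy number `p` (copies are
numbered `0, …, n - 1`). Besides the edges inside the copies there is, for each `p` with
`p + 1 < n`, one edge that joins `t p` in copy `p` to `r (p + 1)` in copy `p + 1`. -/
def chainGraph {n k : ℕ} (G : SimpleGraph (Fin k)) (t r : Fin n → Fin k) :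
    SimpleGraph (Fin n × Fin k) where
  Adj x y := (x.1 = y.1 ∧ G.Adj x.2 y.2) ∨
    (x.1.val + 1 = y.1.val ∧ x.2 = t x.1 ∧ y.2 = r y.1) ∨
    (y.1.val + 1 = x.1.val ∧ y.2 = t y.1 ∧ x.2 = r x.1)
  symm := ⟨by
    rintro x y (⟨h, h'⟩ | h | h)
    · exact Or.inl ⟨h.symm, h'.symm⟩
    · exact Or.inr (Or.inr h)
    · exact Or.inr (Or.inl h)⟩
  loopless := ⟨by
    rintro x (⟨_, h⟩ | ⟨h, _⟩ | ⟨h, _⟩)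
    · exact G.loopless.irrefl _ h
    · omega
    · omega⟩

instance {n k : ℕ} (G : SimpleGraph (Fin k)) [DecidableRel G.Adj] (t r : Fin n → Fin k) :
    DecidableRel (chainGraph G t r).Adj := fun x y =>
  inferInstanceAs (Decidable ((x.1 = y.1 ∧ G.Adj x.2 y.2) ∨
    (x.1.val + 1 = y.1.val ∧ x.2 = t x.1 ∧ y.2 = r y.1) ∨
    (y.1.val + 1 = x.1.val ∧ y.2 = t y.1 ∧ x.2 = r x.1)))

/-- The matrix `Z` whose column number `i` is the difference of the standard basis vectors
at vertex `t i` of copy `i` and at vertex `r (i + 1)` of copy `i + 1`. -/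
def connectionMatrix {n k : ℕ} (t r : Fin n → Fin k) :
    Matrix (Fin n × Fin k) (Fin (n - 1)) ℝ :=
  Matrix.of fun x i =>
    let p : Fin n := ⟨i.val, by omega⟩
    let q : Fin n := ⟨i.val + 1, by omega⟩
    (Pi.single (p, t p) 1 - Pi.single (q, r q) 1 : Fin n × Fin k → ℝ) x

/-- The matrix `I_n ⊗ L + Z Zᵀ`, where `L` is the Laplacian matrix of `G`. -/
def chainLaplacian {n k : ℕ} (G : SimpleGraph (Fin k)) [DecidableRel G.Adj]
    (t r : Fin n → Fin k) : Matrix (Fin n × Fin k) (Fin n × Fin k) ℝ :=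
  (1 : Matrix (Fin n) (Fin n) ℝ) ⊗ₖ G.lapMatrix ℝ +
    connectionMatrix t r * (connectionMatrix t r).transpose

end AntiregularChain

/-!
Let `G` be antiregular on `k` vertices, with Laplacian matrix `L`, and let `r` be degree-repeating.
The other vertices have the degrees `1, …, k - 1`, each once, and counting shows that distinct
vertices are adjacent exactly if their degrees add up to at least `k`
(`DegreesDistinctOff.adj_iff`). So `G` arises from `r` by adding isolated and dominating vertices
in turn. If `B` is the set of the vertices present when `v` is added, `𝟙_B - |B| e_v` is an
eigenvector of `L`, and the eigenvalues so obtained are distinct and positive. An eigenvector `x`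
of `L` is therefore orthogonal to all of these vectors but at most one: its entry at every `v` but
at most one is the mean of the entries on `B`. As the entries of `x` have sum zero unless the
eigenvalue is `0`, when there is no exception, `x r = 0` forces `x = 0`
(`DegreesDistinctOff.eq_zero_of_apply_eq_zero`).

For the chain, let `x` satisfy the eigenvector equation for `μ` and vanish at `r` of the first copy.
If `L` has an eigenvector `u` for `μ`, it does not vanish at any degree-repeating vertex; pairing
the equation on each copy with `u`, from the last copy back to the first, shows that `x` takes the
same value at both ends of each connecting edge. So its restriction to each copy satisfies the
eigenvector equation of `L`, and vanishes, copy by copy. If `μ` is not an eigenvalue of `L`, the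
entry `(r, t)` of `(L - μ)⁻¹` is not zero, which is read off from an explicit solution `y` of
`(L - μ) y = c e_t` with `y r = 1` (`DegreesDistinctOff.exists_mulVec_sub_smul_eq`); again `x`
vanishes copy by copy. Hence no eigenvector of the chain vanishes at that vertex
(`eq_zero_of_chainLaplacian_mulVec_eq`). Every eigenspace then has dimension one, as two independent
eigenvectors for one eigenvalue would have a nonzero combination vanishing there
(`Matrix.IsHermitian.injective_eigenvalues`).
-/

namespace AntiregularChain

open Finset
open scoped Matrix

/-! ### Degrees and adjacency -/

section Laplacian

variable {V : Type*} [Fintype V] [DecidableEq V] (G : SimpleGraph V) [DecidableRel G.Adj]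

/-- No vertex is isolated, and the vertices other than `r` have pairwise distinct degrees. On at
least two vertices this says that `G` is antiregular and that `r` is one of its two
degree-repeating vertices. -/
structure DegreesDistinctOff (r : V) : Prop where
  pos : ∀ v, 0 < G.degree v
  inj : ∀ u v, u ≠ r → v ≠ r → G.degree u = G.degree v → u = v

namespace DegreesDistinctOff

variable {G} {r : V} (h : DegreesDistinctOff G r)
include h

/-- The `card V - 1` vertices other than `r` have distinct degrees in `[1, card V - 1]`, so each
of these values is attained exactly once among them. -/
theorem image_degree : (univ.erase r).image (fun v => G.degree v) = Icc 1 (Fintype.card V - 1) := by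
  apply Finset.eq_of_subset_of_card_le
  · intro d hd
    obtain ⟨v, -, rfl⟩ := mem_image.1 hd
    have h1 := h.pos v
    have h2 := G.degree_lt_card_verts v
    rw [mem_Icc]
    omega
  · rw [card_image_of_injOn]
    · simp [card_erase_of_mem, Finset.card_univ]
    · intro u hu v hv huv
      exact h.inj u v (by simpa using hu) (by simpa using hv) huv

theorem exists_degree_eq {d : ℕ} (hd : 1 ≤ d) (hd' : d < Fintype.card V) :
    ∃ v, v ≠ r ∧ G.degree v = d := by
  have : d ∈ (univ.erase r).image (fun v => G.degree v) := by
    rw [h.image_degree, mem_Icc]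
    omega
  simpa using this

theorem card_filter_degree_mem {i j : ℕ} (hi : 1 ≤ i) (hj : j < Fintype.card V) :
    #{v | v ≠ r ∧ i ≤ G.degree v ∧ G.degree v ≤ j} = j + 1 - i := by
  rw [← Nat.card_Icc, ← card_image_of_injOn (f := fun v => G.degree v)]
  · congr 1
    ext d
    simp only [mem_image, mem_filter, mem_univ, true_and, mem_Icc]
    constructor
    · rintro ⟨v, ⟨-, h1, h2⟩, rfl⟩
      exact ⟨h1, h2⟩
    · rintro ⟨h1, h2⟩
      obtain ⟨v, hv, rfl⟩ := h.exists_degree_eq (d := d) (by omega) (by omega)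
      exact ⟨v, ⟨hv, h1, h2⟩, rfl⟩
  · intro u hu v hv huv
    simp only [coe_filter, mem_univ, true_and, Set.mem_ofPred_eq] at hu hv
    exact h.inj u v hu.1 hv.1 huv

/-- The graph is determined by its degrees. The proof is by induction on the distance `m` of the
degree to the nearer end of `[0, card V]`: the vertices of smaller distance supply `m - 1`
non-neighbors of a vertex of degree `card V - m`, which is all it has, and then `m` neighbors of a
vertex of degree `m`, which again is all. -/
theorem adj_iff {u v : V} (huv : u ≠ v) :
    G.Adj u v ↔ Fintype.card V ≤ G.degree u + G.degree v := by
  set k := Fintype.card V with hk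
  have key : ∀ m, 2 * m ≤ k → ∀ v w, v ≠ w → (G.degree v + m = k ∨ G.degree v = m) →
      (G.Adj v w ↔ k ≤ G.degree v + G.degree w) := by
    intro m
    induction m using Nat.strong_induction_on with
    | _ m ih =>
      intro hm
      have large : ∀ v w, v ≠ w → G.degree v + m = k →
          (G.Adj v w ↔ k ≤ G.degree v + G.degree w) := by
        intro v w hvw hv
        have hpos := h.pos v
        have hlt := G.degree_lt_card_verts v
        have hsub : ({w | G.degree w < m} : Finset V) ⊆ (G.neighborFinset v)ᶜ.erase v := by
          intro w hw
          simp only [mem_filter, mem_univ, true_and] at hw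
          have hwv : w ≠ v := by rintro rfl; omega
          have := ih (G.degree w) hw (by omega) w v hwv (Or.inr rfl)
          simp only [mem_erase, mem_compl, SimpleGraph.mem_neighborFinset]
          refine ⟨hwv, fun hadj => ?_⟩
          have := this.1 hadj.symm
          omega
        have hle : #((G.neighborFinset v)ᶜ.erase v) ≤ #({w | G.degree w < m} : Finset V) := by
          rw [card_erase_of_mem (by simp), card_compl, SimpleGraph.card_neighborFinset_eq_degree]
          have h1 := h.card_filter_degree_mem (i := 1) (j := m - 1) le_rfl (by omega)
          have h2 : #{v | v ≠ r ∧ 1 ≤ G.degree v ∧ G.degree v ≤ m - 1}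
              ≤ #({w | G.degree w < m} : Finset V) := by
            apply card_le_card
            intro w hw
            simp only [mem_filter, mem_univ, true_and] at hw ⊢
            omega
          omega
        have hw := Finset.ext_iff.1 (eq_of_subset_of_card_le hsub hle) w
        simp only [mem_filter, mem_univ, true_and, mem_erase, mem_compl,
          SimpleGraph.mem_neighborFinset] at hw
        have : G.degree w < m ↔ ¬ G.Adj v w := by rw [hw]; simp [hvw.symm]
        rw [← not_iff_not, ← this]
        omega
      rintro v w hvw (hv | hv)
      · exact large v w hvw hv
      by_cases h2m : 2 * m = k
      · exact large v w hvw (by omega)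
      have hpos := h.pos v
      have hsub : ({w | k ≤ G.degree w + m} : Finset V) ⊆ G.neighborFinset v := by
        intro w hw
        simp only [mem_filter, mem_univ, true_and] at hw
        have hwv : w ≠ v := by rintro rfl; omega
        have hlt := G.degree_lt_card_verts w
        rw [SimpleGraph.mem_neighborFinset, SimpleGraph.adj_comm]
        by_cases hwm : G.degree w + m = k
        · exact (large w v hwv hwm).2 (by omega)
        · exact (ih (k - G.degree w) (by omega) (by omega) w v hwv (Or.inl (by omega))).2
            (by omega)
      have hle : #(G.neighborFinset v) ≤ #({w | k ≤ G.degree w + m} : Finset V) := by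
        rw [SimpleGraph.card_neighborFinset_eq_degree]
        have h1 := h.card_filter_degree_mem (i := k - m) (j := k - 1) (by omega) (by omega)
        have h2 : #{v | v ≠ r ∧ k - m ≤ G.degree v ∧ G.degree v ≤ k - 1}
            ≤ #({w | k ≤ G.degree w + m} : Finset V) := by
          apply card_le_card
          intro w hw
          simp only [mem_filter, mem_univ, true_and] at hw ⊢
          omega
        omega
      have hw := Finset.ext_iff.1 (eq_of_subset_of_card_le hsub hle) w
      simp only [mem_filter, mem_univ, true_and, SimpleGraph.mem_neighborFinset] at hw
      rw [← hw]
      omega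
  have hlt := G.degree_lt_card_verts u
  rcases le_total (2 * G.degree u) k with hu | hu
  · exact key _ hu u v huv (Or.inr rfl)
  · exact key (k - G.degree u) (by omega) u v huv (Or.inl (by omega))

/-- Counting the non-neighbors of a vertex of degree `card V - card V / 2` bounds the degree of `r`
from below, and counting the neighbors of a vertex of degree `(card V - 1) / 2` bounds it from
above. -/
theorem degree_eq_card_div_two : G.degree r = Fintype.card V / 2 := by
  have hr := h.pos r
  have hr' := G.degree_lt_card_verts r
  set k := Fintype.card V with hk
  apply le_antisymm
  · by_contra! hlt
    obtain ⟨v, hvr, hv⟩ := h.exists_degree_eq (d := (k - 1) / 2) (by omega) (by omega)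
    have hsub :
        insert r ({w | w ≠ r ∧ k - (k - 1) / 2 ≤ G.degree w ∧ G.degree w ≤ k - 1} : Finset V)
          ⊆ G.neighborFinset v := by
      intro w hw
      have hw' : k ≤ G.degree v + G.degree w := by
        simp only [mem_insert, mem_filter, mem_univ, true_and] at hw
        rcases hw with rfl | hw <;> omega
      rw [SimpleGraph.mem_neighborFinset, h.adj_iff (by rintro rfl; omega)]
      exact hw'
    have h1 := card_le_card hsub
    rw [card_insert_of_notMem (by simp), h.card_filter_degree_mem (by omega) (by omega),
      SimpleGraph.card_neighborFinset_eq_degree] at h1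
    omega
  · by_contra! hlt
    obtain ⟨v, hvr, hv⟩ := h.exists_degree_eq (d := k - k / 2) (by omega) (by omega)
    have hsub : insert r ({w | w ≠ r ∧ 1 ≤ G.degree w ∧ G.degree w ≤ k / 2 - 1} : Finset V)
        ⊆ (G.neighborFinset v)ᶜ.erase v := by
      intro w hw
      have hw' : G.degree v + G.degree w < k := by
        simp only [mem_insert, mem_filter, mem_univ, true_and] at hw
        rcases hw with rfl | hw <;> omega
      have hwv : w ≠ v := by rintro rfl; omega
      simp only [mem_erase, mem_compl, SimpleGraph.mem_neighborFinset, h.adj_iff hwv.symm]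
      exact ⟨hwv, by omega⟩
    have h1 := card_le_card hsub
    rw [card_insert_of_notMem (by simp), h.card_filter_degree_mem (by omega) (by omega),
      card_erase_of_mem (by simp), card_compl, SimpleGraph.card_neighborFinset_eq_degree] at h1
    omega

end DegreesDistinctOff

/-! ### Eigenvectors of the Laplacian matrix of an antiregular graph -/

theorem lapMatrix_mulVec_apply_eq_sum (x : V → ℝ) (v : V) :
    (G.lapMatrix ℝ *ᵥ x) v = ∑ w, if G.Adj v w then x v - x w else 0 := by
  rw [SimpleGraph.lapMatrix_mulVec_apply, SimpleGraph.degree_eq_sum_if_adj, sum_mul,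
    SimpleGraph.neighborFinset_eq_filter, sum_filter, ← sum_sub_distrib]
  refine sum_congr rfl fun w _ => ?_
  split_ifs <;> simp

omit [Fintype V] [DecidableEq V] in
theorem sum_sum_adj_sub_eq_zero (B : Finset V) (x : V → ℝ) :
    ∑ z ∈ B, ∑ w ∈ B, (if G.Adj z w then x z - x w else 0) = 0 := by
  have h : ∑ z ∈ B, ∑ w ∈ B, (if G.Adj z w then x z - x w else 0)
      = - ∑ z ∈ B, ∑ w ∈ B, (if G.Adj z w then x z - x w else 0) := by
    conv_lhs => rw [sum_comm]
    rw [← sum_neg_distrib]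
    refine sum_congr rfl fun z _ => ?_
    rw [← sum_neg_distrib]
    refine sum_congr rfl fun w _ => ?_
    simp only [G.adj_comm w z]
    split_ifs <;> simp
  linarith

theorem sum_lapMatrix_mulVec (x : V → ℝ) : ∑ v, (G.lapMatrix ℝ *ᵥ x) v = 0 := by
  simp only [lapMatrix_mulVec_apply_eq_sum]
  exact sum_sum_adj_sub_eq_zero G univ x

/-- If `v` is joined to all of `B` or to none of it (according to `s`), and a vertex outside of
`insert v B` has either all of `insert v B` as neighbors or none of it, then `𝟙_B - |B| e_v` is an
eigenvector of the symmetric matrix `L`, with eigenvalue `deg v` or `deg v + 1`. The lemma is this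
relation paired with `x`. -/
theorem sum_lapMatrix_mulVec_sub {B : Finset V} {v : V} (hv : v ∉ B) (s : Prop) [Decidable s]
    (hs : ∀ z ∈ B, (G.Adj v z ↔ s))
    (hout : ∀ z ∈ B, ∀ w, w ∉ B → w ≠ v → (G.Adj z w ↔ G.Adj v w)) (x : V → ℝ) :
    ∑ z ∈ B, (G.lapMatrix ℝ *ᵥ x) z - #B * (G.lapMatrix ℝ *ᵥ x) v
      = (G.degree v + if s then 1 else 0) * (∑ z ∈ B, x z - #B * x v) := by
  set C : Finset V := (insert v B)ᶜ with hC
  have split (f : V → ℝ) : ∑ w, f w = ∑ w ∈ B, f w + f v + ∑ w ∈ C, f w := by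
    rw [← sum_add_sum_compl (insert v B) f, sum_insert hv, add_comm (f v)]
  set σ : ℝ := if s then 1 else 0 with hσ
  set o : ℝ := ∑ w ∈ C, if G.Adj v w then 1 else 0 with ho
  set q : ℝ := ∑ w ∈ C, if G.Adj v w then x w else 0 with hq
  have hadj : ∀ z ∈ B, ∀ c : ℝ, (if G.Adj v z then c else 0) = σ * c := by
    intro z hz c
    simp only [hs z hz, hσ]
    split_ifs <;> simp
  have hdeg : (G.degree v : ℝ) = σ * #B + o := by
    rw [SimpleGraph.degree_eq_sum_if_adj, split, sum_congr rfl fun z hz => hadj z hz 1]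
    simp [mul_comm, ho]
  have hsumC (a : ℝ) : (∑ w ∈ C, if G.Adj v w then a - x w else 0) = o * a - q := by
    rw [ho, hq, sum_mul, ← sum_sub_distrib]
    refine sum_congr rfl fun w _ => ?_
    split_ifs <;> simp
  have hLv : (G.lapMatrix ℝ *ᵥ x) v = σ * (#B * x v - ∑ z ∈ B, x z) + (o * x v - q) := by
    rw [lapMatrix_mulVec_apply_eq_sum, split, sum_congr rfl fun z hz => hadj z hz (x v - x z),
      ← mul_sum, sum_sub_distrib, hsumC]
    simp
  have hLB : ∑ z ∈ B, (G.lapMatrix ℝ *ᵥ x) z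
      = σ * (∑ z ∈ B, x z - #B * x v) + (o * ∑ z ∈ B, x z - #B * q) := by
    have hz : ∀ z ∈ B, (G.lapMatrix ℝ *ᵥ x) z
        = (∑ w ∈ B, if G.Adj z w then x z - x w else 0) + σ * (x z - x v) + (o * x z - q) := by
      intro z hz
      rw [lapMatrix_mulVec_apply_eq_sum, split, ← hsumC, ← hadj z hz]
      simp only [G.adj_comm z v, add_right_inj]
      refine sum_congr rfl fun w hw => ?_
      simp only [hC, mem_compl, mem_insert, not_or] at hw
      simp only [hout z hz w hw.2 hw.1]
    rw [sum_congr rfl hz, sum_add_distrib, sum_add_distrib, sum_sum_adj_sub_eq_zero,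
      sum_sub_distrib, ← mul_sum, ← mul_sum, sum_sub_distrib]
    simp
  rw [hLB, hLv, hdeg]
  ring

omit [DecidableEq V] in
/-- If every entry is `0` or the mean of the entries of smaller rank, then all entries vanish,
by induction on the rank. -/
theorem eq_zero_of_mean_of_lower_rank {ρ : V → ℕ} {x : V → ℝ}
    (hx : ∀ v, x v = 0 ∨
      (({w | ρ w < ρ v} : Finset V).Nonempty ∧ ∑ w with ρ w < ρ v, x w = #{w | ρ w < ρ v} * x v)) :
    x = 0 := by
  have key : ∀ n v, ρ v = n → x v = 0 := by
    intro n
    induction n using Nat.strong_induction_on with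
    | _ n ih =>
      intro v hv
      rcases hx v with h0 | ⟨hne, hmean⟩
      · exact h0
      rw [sum_eq_zero fun w hw => ih (ρ w) (hv ▸ (mem_filter.1 hw).2) w rfl] at hmean
      have : (#{w | ρ w < ρ v} : ℝ) ≠ 0 := by exact_mod_cast hne.card_pos.ne'
      exact (mul_eq_zero.1 hmean.symm).resolve_left this
  exact funext fun v => key _ v rfl

omit [DecidableEq V] in
/-- One vertex `v₀` may violate the mean value condition if the entries have sum zero: every
entry then has the sign of `x v₀`, so that all are zero. -/
theorem eq_zero_of_mean_of_lower_rank_of_sum {ρ : V → ℕ} {x : V → ℝ} (hsum : ∑ v, x v = 0) (v₀ : V)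
    (hx : ∀ v, v ≠ v₀ → x v = 0 ∨
      (({w | ρ w < ρ v} : Finset V).Nonempty ∧ ∑ w with ρ w < ρ v, x w = #{w | ρ w < ρ v} * x v)) :
    x = 0 := by
  have key : ∀ n v, ρ v = n → 0 ≤ x v₀ * x v := by
    intro n
    induction n using Nat.strong_induction_on with
    | _ n ih =>
      intro v hv
      by_cases hv₀ : v = v₀
      · rw [hv₀]
        exact mul_self_nonneg _
      rcases hx v hv₀ with h0 | ⟨hne, hmean⟩
      · simp [h0]
      have hpos : (0 : ℝ) < #{w | ρ w < ρ v} := by exact_mod_cast hne.card_pos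
      have h1 : 0 ≤ ∑ w with ρ w < ρ v, x v₀ * x w :=
        sum_nonneg fun w hw => ih (ρ w) (hv ▸ (mem_filter.1 hw).2) w rfl
      rw [← mul_sum, hmean, mul_left_comm] at h1
      exact nonneg_of_mul_nonneg_right h1 hpos
  have h0 : x v₀ = 0 := by
    have h1 : ∑ v, x v₀ * x v = 0 := by rw [← mul_sum, hsum, mul_zero]
    have := (sum_eq_zero_iff_of_nonneg fun v _ => key _ v rfl).1 h1 v₀ (mem_univ _)
    exact mul_self_eq_zero.1 this
  refine eq_zero_of_mean_of_lower_rank (ρ := ρ) fun v => ?_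
  by_cases hv : v = v₀
  · exact Or.inl (hv ▸ h0)
  · exact hx v hv

namespace DegreesDistinctOff

/-- The position of a vertex in the construction of an antiregular graph that starts from `r` and
adds isolated and dominating vertices in turn; the vertices of degree below half the number of
vertices are the ones that are added as isolated vertices. -/
def rank (G : SimpleGraph V) [DecidableRel G.Adj] (r v : V) : ℕ :=
  if v = r then 0
  else if 2 * G.degree v < Fintype.card V then Fintype.card V - 2 * G.degree v
  else 2 * G.degree v + 1 - Fintype.card V

variable {G} {r : V} (h : DegreesDistinctOff G r)
include h

/-- The eigenvector relation of `sum_lapMatrix_mulVec_sub`, for the set of the vertices of smaller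
rank. -/
theorem eigenvalue_sub_mul_eq_zero {μ : ℝ} {x : V → ℝ} (hx : G.lapMatrix ℝ *ᵥ x = μ • x)
    {v : V} (hv : v ≠ r) :
    ((G.degree v + if Fintype.card V ≤ 2 * G.degree v then 1 else 0) - μ) *
      (∑ w with rank G r w < rank G r v, x w - #{w | rank G r w < rank G r v} * x v) = 0 := by
  have hD := h.degree_eq_card_div_two
  have hDpos := h.pos r
  have hne : ∀ w, w ≠ r → w ≠ v → G.degree w ≠ G.degree v := fun w hw hwv hd =>
    hwv (h.inj w v hw hv hd)
  have key := sum_lapMatrix_mulVec_sub G (B := {w | rank G r w < rank G r v}) (v := v) (by simp)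
    (Fintype.card V ≤ 2 * G.degree v) ?_ ?_ x
  · rw [hx] at key
    simp only [Pi.smul_apply, smul_eq_mul, ← mul_sum] at key
    linarith
  · intro z hz
    simp only [mem_filter, mem_univ, true_and] at hz
    rw [h.adj_iff (by rintro rfl; omega)]
    by_cases hzr : z = r
    · subst hzr
      omega
    · simp only [rank, hzr, hv, if_false] at hz
      split_ifs at hz <;> omega
  · intro z hz w hw hwv
    simp only [mem_filter, mem_univ, true_and] at hz hw
    have hwr : w ≠ r := by
      rintro rfl
      simp only [rank, hv, if_true, if_false] at hw
      split_ifs at hw <;> omega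
    rw [h.adj_iff (by rintro rfl; omega), h.adj_iff hwv.symm]
    have := hne w hwr hwv
    by_cases hzr : z = r
    · subst hzr
      simp only [rank, hwr, hv, if_false] at hw
      split_ifs at hw <;> omega
    · simp only [rank, hzr, hwr, hv, if_false] at hz hw
      split_ifs at hz hw <;> omega

/-- An eigenvector of the Laplacian matrix of an antiregular graph does not vanish at a
degree-repeating vertex. -/
theorem eq_zero_of_apply_eq_zero {μ : ℝ} {x : V → ℝ} (hx : G.lapMatrix ℝ *ᵥ x = μ • x)
    (hr : x r = 0) : x = 0 := by
  have hmean : ∀ v, (G.degree v + if Fintype.card V ≤ 2 * G.degree v then 1 else 0 : ℝ) ≠ μ →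
      x v = 0 ∨ (({w | rank G r w < rank G r v} : Finset V).Nonempty ∧
        ∑ w with rank G r w < rank G r v, x w = #{w | rank G r w < rank G r v} * x v) := by
    intro v hμ
    by_cases hv : v = r
    · exact Or.inl (hv ▸ hr)
    refine Or.inr ⟨⟨r, ?_⟩, ?_⟩
    · simp only [mem_filter, mem_univ, true_and, rank, hv, if_true, if_false]
      split_ifs <;> omega
    · exact sub_eq_zero.1 <|
        (mul_eq_zero.1 (h.eigenvalue_sub_mul_eq_zero hx hv)).resolve_left (sub_ne_zero.2 hμ)
  by_cases hμ0 : μ = 0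
  · refine eq_zero_of_mean_of_lower_rank fun v => hmean v ?_
    have : (0 : ℝ) < G.degree v := by exact_mod_cast h.pos v
    rw [hμ0]
    split_ifs <;> positivity
  have hsum : ∑ v, x v = 0 := by
    have h1 := sum_lapMatrix_mulVec G x
    rw [hx] at h1
    simp only [Pi.smul_apply, smul_eq_mul, ← mul_sum] at h1
    exact (mul_eq_zero.1 h1).resolve_left hμ0
  -- The numbers compared with `μ` are distinct for distinct vertices other than `r`.
  by_cases hex : ∃ v, v ≠ r ∧
      (G.degree v + if Fintype.card V ≤ 2 * G.degree v then 1 else 0 : ℝ) = μ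
  · obtain ⟨v₀, hv₀, hμ⟩ := hex
    refine eq_zero_of_mean_of_lower_rank_of_sum (ρ := rank G r) hsum v₀ fun v hv => ?_
    by_cases hvr : v = r
    · exact Or.inl (hvr ▸ hr)
    refine hmean v fun hμ' => hv (h.inj v v₀ hvr hv₀ ?_)
    rw [← hμ] at hμ'
    have : G.degree v + (if Fintype.card V ≤ 2 * G.degree v then 1 else 0)
        = G.degree v₀ + (if Fintype.card V ≤ 2 * G.degree v₀ then 1 else 0) := by
      exact_mod_cast hμ'
    split_ifs at this <;> omega
  · push Not at hex
    refine eq_zero_of_mean_of_lower_rank_of_sum (ρ := rank G r) hsum r fun v hv => hmean v (hex v hv)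

/-- Let `t ≠ r` be a terminal vertex. Where `L - μ` is invertible, a multiple of the
column `t` of the inverse has entry `1` at `r`; its entries are polynomials in `μ`. They follow
from `L e_t = e_t - e_d` and `L e_d = k e_d - 𝟙`, where the dominating vertex `d` is the neighbor
of `t`. For `k = 2` this neighbor is `r` itself, and the normalization is different. -/
theorem exists_mulVec_sub_smul_eq {t : V} (htr : t ≠ r) (ht : G.degree t = 1) (μ : ℝ) :
    ∃ (y : V → ℝ) (c : ℝ), y r = 1 ∧ G.lapMatrix ℝ *ᵥ y - μ • y = c • Pi.single t 1 := by
  have hD := h.degree_eq_card_div_two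
  have hcard : 2 ≤ Fintype.card V := by
    have := G.degree_lt_card_verts t
    omega
  obtain ⟨d, -, hd⟩ := h.exists_degree_eq (d := Fintype.card V - 1) (by omega) (by omega)
  have hdt_adj : d ≠ t → G.Adj t d := by
    intro hdt
    rw [h.adj_iff hdt.symm]
    omega
  have hone : G.lapMatrix ℝ *ᵥ (1 : V → ℝ) = 0 := G.lapMatrix_mulVec_const_eq_zero
  have hadj_t : ∀ u, G.Adj t u → ∀ w, G.Adj t w ↔ w = u := by
    intro u hu w
    rw [SimpleGraph.degree, card_eq_one] at ht
    obtain ⟨a, ha⟩ := ht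
    have hmem : ∀ w, G.Adj t w ↔ w = a := fun w => by
      rw [← SimpleGraph.mem_neighborFinset, ha, mem_singleton]
    rw [hmem, (hmem u).1 hu]
  have hLt : ∀ u, G.Adj t u →
      G.lapMatrix ℝ *ᵥ Pi.single t 1 = (Pi.single t 1 - Pi.single u 1 : V → ℝ) := by
    intro u hu
    ext v
    have htu : t ≠ u := hu.ne
    rw [SimpleGraph.lapMatrix_mulVec_apply]
    simp only [Pi.single_apply, Pi.sub_apply, sum_ite_eq', SimpleGraph.mem_neighborFinset,
      G.adj_comm v t, hadj_t u hu v]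
    by_cases hv : v = t
    · subst hv
      simp [ht, htu]
    · simp [hv]
  by_cases hk : Fintype.card V = 2
  · have hrt : G.Adj t r := by
      rw [h.adj_iff htr]
      omega
    have huniv : (univ : Finset V) = {t, r} :=
      (eq_of_subset_of_card_le (subset_univ _) (by simp [hk, htr])).symm
    have h1 : (1 : V → ℝ) = Pi.single t 1 + Pi.single r 1 := by
      ext v
      have : v = t ∨ v = r := by simpa [huniv] using mem_univ v
      rcases this with rfl | rfl <;> simp [htr, htr.symm]
    refine ⟨1 - μ • Pi.single t 1, μ ^ 2 - 2 * μ, by simp [htr.symm], ?_⟩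
    rw [Matrix.mulVec_sub, hone, Matrix.mulVec_smul, hLt r hrt, h1]
    ext v
    simp only [Pi.sub_apply, Pi.smul_apply, Pi.add_apply, Pi.zero_apply, smul_eq_mul]
    ring
  · have hdt : d ≠ t := by rintro rfl; omega
    have hdr : d ≠ r := by rintro rfl; omega
    have hLd : G.lapMatrix ℝ *ᵥ Pi.single d 1
        = ((Fintype.card V : ℝ) • Pi.single d 1 - 1 : V → ℝ) := by
      ext v
      rw [SimpleGraph.lapMatrix_mulVec_apply]
      simp only [Pi.single_apply, Pi.sub_apply, Pi.smul_apply, sum_ite_eq',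
        SimpleGraph.mem_neighborFinset, Pi.one_apply, smul_eq_mul]
      by_cases hv : v = d
      · subst hv
        simp [hd, Nat.cast_sub (show 1 ≤ Fintype.card V by omega)]
      · have hadj : G.Adj v d := by
          rw [h.adj_iff hv]
          have := h.pos v
          omega
        simp [hv, hadj]
    refine ⟨1 - μ • Pi.single d 1 + (μ ^ 2 - Fintype.card V * μ) • Pi.single t 1,
      (μ ^ 2 - Fintype.card V * μ) * (1 - μ), by simp [htr.symm, hdr.symm], ?_⟩
    rw [Matrix.mulVec_add, Matrix.mulVec_sub, hone, Matrix.mulVec_smul, Matrix.mulVec_smul,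
      hLt d (hdt_adj hdt), hLd]
    ext v
    simp only [Pi.sub_apply, Pi.smul_apply, Pi.add_apply, Pi.zero_apply, Pi.one_apply, smul_eq_mul]
    ring

end DegreesDistinctOff

end Laplacian

/-! ### The chain of copies -/

theorem IsAntiregular.degreesDistinctOff {k : ℕ} {G : SimpleGraph (Fin k)} [DecidableRel G.Adj]
    (hG : IsAntiregular G) {r : Fin k} (hr : IsDegreeRepeating G r) : DegreesDistinctOff G r := by
  obtain ⟨hconn, a, b, hab, -, huniq⟩ := hG
  obtain ⟨w, hwr, hw⟩ := hr
  have : Nontrivial (Fin k) := ⟨a, b, hab⟩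
  refine ⟨fun v => hconn.preconnected.degree_pos_of_nontrivial v, fun u v hu hv huv => ?_⟩
  by_contra hne
  have h1 := huniq u v hne huv
  have h2 := huniq w r hwr hw
  grind

section Chain

variable {n k : ℕ} (G : SimpleGraph (Fin k)) [DecidableRel G.Adj] (t r : Fin n → Fin k)

theorem connectionMatrix_apply (p : Fin n) (v : Fin k) (i : Fin (n - 1)) :
    connectionMatrix t r (p, v) i =
      (if p.val = i.val ∧ v = t p then 1 else 0) -
        (if p.val = i.val + 1 ∧ v = r p then 1 else 0) := by
  simp only [connectionMatrix, Matrix.of_apply, Pi.sub_apply, Pi.single_apply, Prod.mk.injEq,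
    Fin.ext_iff (a := p)]
  congr 2
  · refine propext (and_congr_right fun h => ?_)
    rw [show p = ⟨i.val, by omega⟩ from Fin.ext h]
  · refine propext (and_congr_right fun h => ?_)
    rw [show p = ⟨i.val + 1, by omega⟩ from Fin.ext h]

theorem sum_connectionMatrix (i : Fin (n - 1)) : ∑ a, connectionMatrix t r a i = 0 := by
  simp [connectionMatrix, Finset.sum_sub_distrib]

/-- Two square matrices with zero row sums are equal if they agree off the diagonal. -/
theorem _root_.Matrix.eq_of_mulVec_one_eq_zero {ι : Type*} [Fintype ι] [DecidableEq ι]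
    {A B : Matrix ι ι ℝ} (hA : A *ᵥ 1 = 0) (hB : B *ᵥ 1 = 0) (h : ∀ i j, i ≠ j → A i j = B i j) :
    A = B := by
  ext i j
  by_cases hij : i = j
  · subst hij
    have h1 := congrFun hA i
    have h2 := congrFun hB i
    simp only [Matrix.mulVec, dotProduct, Pi.one_apply, mul_one, Pi.zero_apply] at h1 h2
    rw [← add_sum_erase _ _ (mem_univ i)] at h1 h2
    have h3 : ∑ j ∈ univ.erase i, A i j = ∑ j ∈ univ.erase i, B i j :=
      sum_congr rfl fun j hj => h i j (ne_of_mem_erase hj).symm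
    linarith
  · exact h i j hij

theorem connectionMatrix_mul_transpose_apply_of_ne {a b : Fin n × Fin k} (hab : a ≠ b) :
    (connectionMatrix t r * (connectionMatrix t r)ᵀ) a b =
      if (a.1.val + 1 = b.1.val ∧ a.2 = t a.1 ∧ b.2 = r b.1) ∨
        (b.1.val + 1 = a.1.val ∧ b.2 = t b.1 ∧ a.2 = r a.1) then -1 else 0 := by
  obtain ⟨p, v⟩ := a
  obtain ⟨q, w⟩ := b
  simp only [Matrix.mul_apply, Matrix.transpose_apply, connectionMatrix_apply]
  split_ifs with h
  · have hlt : min p.val q.val < n - 1 := by omega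
    rw [sum_eq_single ⟨min p.val q.val, hlt⟩]
    · rcases h with ⟨h1, h2, h3⟩ | ⟨h1, h2, h3⟩ <;> simp [h2, h3, ← h1]
    · intro i _ hi
      have : i.val ≠ min p.val q.val := fun e => hi (Fin.ext e)
      split_ifs <;> first | omega | simp
    · simp
  · refine sum_eq_zero fun i _ => ?_
    split_ifs with h1 h2 h3 h4 h5 h6 h7
    all_goals try simp
    all_goals
      exfalso
      have hpq : p = q → v ≠ w := fun e e' => hab (by rw [e, e'])
      grind

theorem lapMatrix_chainGraph : (chainGraph G t r).lapMatrix ℝ = chainLaplacian G t r := by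
  refine Matrix.eq_of_mulVec_one_eq_zero (SimpleGraph.lapMatrix_mulVec_const_eq_zero _) ?_ ?_
  · ext a
    simp only [chainLaplacian, Matrix.add_mulVec, ← Matrix.mulVec_mulVec]
    have h1 : (connectionMatrix t r)ᵀ *ᵥ 1 = 0 := by
      ext i
      simpa [Matrix.mulVec, dotProduct] using sum_connectionMatrix t r i
    have h2 := congrFun (G.lapMatrix_mulVec_const_eq_zero (R := ℝ)) a.2
    simp only [Matrix.mulVec, dotProduct, mul_one, Pi.zero_apply] at h2
    rw [h1, Matrix.mulVec_zero, add_zero]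
    simp only [Matrix.mulVec, dotProduct, Fintype.sum_prod_type, Matrix.kroneckerMap_apply,
      Pi.one_apply, Pi.zero_apply, mul_one]
    refine sum_eq_zero fun q _ => ?_
    exact (mul_sum _ _ ((1 : Matrix (Fin n) (Fin n) ℝ) a.1 q)).symm.trans (by rw [h2, mul_zero])
  · intro a b hab
    rw [chainLaplacian, Matrix.add_apply, connectionMatrix_mul_transpose_apply_of_ne t r hab]
    simp only [SimpleGraph.lapMatrix, SimpleGraph.degMatrix, Matrix.sub_apply,
      Matrix.kroneckerMap_apply, Matrix.diagonal_apply, SimpleGraph.adjMatrix_apply, hab, if_false,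
      Matrix.one_apply]
    have hadj : (chainGraph G t r).Adj a b ↔ (a.1 = b.1 ∧ G.Adj a.2 b.2) ∨
        (a.1.val + 1 = b.1.val ∧ a.2 = t a.1 ∧ b.2 = r b.1) ∨
        (b.1.val + 1 = a.1.val ∧ b.2 = t b.1 ∧ a.2 = r a.1) := Iff.rfl
    simp only [hadj]
    by_cases h1 : a.1 = b.1
    · have h2 : a.2 ≠ b.2 := fun h2 => hab (Prod.ext h1 h2)
      simp [h1, h2]
    · simp only [h1, false_and, false_or, if_false, zero_mul, zero_add, zero_sub]
      split_ifs <;> simp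

/-- The difference of `x` along the edge from copy `p - 1` to copy `p`. It is `0` if there is no
such edge, in particular for `p = 0` and `p = n`, so that the first and the last copy satisfy the
same equations as the others. -/
def jump (x : Fin n × Fin k → ℝ) (p : ℕ) : ℝ :=
  if h : 1 ≤ p ∧ p < n then
    x (⟨p - 1, by omega⟩, t ⟨p - 1, by omega⟩) - x (⟨p, h.2⟩, r ⟨p, h.2⟩) else 0

theorem jump_zero (x : Fin n × Fin k → ℝ) : jump t r x 0 = 0 := by
  simp [jump]

theorem jump_self (x : Fin n × Fin k → ℝ) : jump t r x n = 0 := by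
  simp [jump]

theorem transpose_connectionMatrix_mulVec (x : Fin n × Fin k → ℝ) (i : Fin (n - 1)) :
    ((connectionMatrix t r)ᵀ *ᵥ x) i = jump t r x (i.val + 1) := by
  have : i.val + 1 < n := by omega
  simp [Matrix.mulVec, dotProduct, connectionMatrix, jump, sub_mul, sum_sub_distrib, this,
    Pi.single_apply]

theorem chainLaplacian_mulVec (x : Fin n × Fin k → ℝ) (p : Fin n) (v : Fin k) :
    (chainLaplacian G t r *ᵥ x) (p, v) = (G.lapMatrix ℝ *ᵥ fun w => x (p, w)) v
      + (if v = t p then jump t r x (p + 1) else 0) - (if v = r p then jump t r x p else 0) := by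
  rw [chainLaplacian, Matrix.add_mulVec, ← Matrix.mulVec_mulVec, Pi.add_apply, add_sub_assoc]
  congr 1
  · simp [Matrix.mulVec, dotProduct, Fintype.sum_prod_type, Matrix.kroneckerMap_apply,
      Matrix.one_apply]
  · rw [Matrix.mulVec, dotProduct]
    simp only [transpose_connectionMatrix_mulVec, connectionMatrix_apply, sub_mul, sum_sub_distrib]
    congr 1
    · by_cases hv : v = t p
      · by_cases hp : p.val < n - 1
        · rw [sum_eq_single ⟨p.val, hp⟩] <;> simp [hv]
          intro i hi hi'
          exact absurd (Fin.ext hi'.symm) hi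
        · have : p.val + 1 = n := by omega
          rw [this, jump_self, if_pos hv]
          refine sum_eq_zero fun i _ => ?_
          rw [if_neg (by omega), zero_mul]
      · simp [hv]
    · by_cases hv : v = r p
      · by_cases hp : 0 < p.val
        · rw [sum_eq_single ⟨p.val - 1, by omega⟩]
          · simp [hv, Nat.sub_add_cancel hp]
          · intro i _ hi
            rw [if_neg, zero_mul]
            rintro ⟨h, -⟩
            exact hi (Fin.ext (by simp [h]))
          · simp
        · have : p.val = 0 := by omega
          rw [this, jump_zero]
          simp
      · simp [hv]

variable {G t r}

/-- The restriction of `x` to copy `p` satisfies the eigenvector equation of `G` up to the jumps at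
`r p` and `t p`. If `μ` is an eigenvalue of `G`, with eigenvector `u`, pairing with `u` shows that
the jump at `r p` vanishes as soon as the one at `t p` does; so all vanish, starting from the
last copy. If not, `x` vanishes copy by copy from the first one on, as the entry `(r p, t p)` of the
inverse of `L - μ` is not zero. -/
theorem eq_zero_of_chainLaplacian_mulVec_eq (hr : ∀ p, DegreesDistinctOff G (r p))
    (ht : ∀ p, G.degree (t p) = 1) (htr : ∀ p, t p ≠ r p) (hn : 1 ≤ n) {μ : ℝ}
    {x : Fin n × Fin k → ℝ} (hx : chainLaplacian G t r *ᵥ x = μ • x)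
    (hx0 : x (⟨0, hn⟩, r ⟨0, hn⟩) = 0) : x = 0 := by
  have heq (p : Fin n) : G.lapMatrix ℝ *ᵥ (fun w => x (p, w)) - μ • (fun w => x (p, w))
      = jump t r x p • Pi.single (r p) 1 - jump t r x (p + 1) • Pi.single (t p) 1 := by
    ext v
    have h1 := chainLaplacian_mulVec G t r x p v
    rw [hx] at h1
    simp only [Pi.smul_apply, Pi.sub_apply, smul_eq_mul, Pi.single_apply, mul_ite, mul_one,
      mul_zero] at h1 ⊢
    linarith
  -- A copy with no jump at `r p` and a zero at `r p` vanishes if there is no jump at `t p` either.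
  have hcopy (p : Fin n) (h0 : jump t r x p = 0) (h1 : jump t r x (p + 1) = 0)
      (hxr : x (p, r p) = 0) : (fun w => x (p, w)) = 0 := by
    refine (hr p).eq_zero_of_apply_eq_zero (μ := μ) ?_ hxr
    rw [← sub_eq_zero, heq, h0, h1, zero_smul, zero_smul, sub_zero]
  have hjump : ∀ p : Fin n, jump t r x p = 0 → x (p, r p) = 0 → jump t r x (p + 1) = 0 := by
    by_cases hex : ∃ u : Fin k → ℝ, u ≠ 0 ∧ G.lapMatrix ℝ *ᵥ u = μ • u
    · obtain ⟨u, hu0, hu⟩ := hex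
      have hpair (p : Fin n) : jump t r x p * u (r p) = jump t r x (p + 1) * u (t p) := by
        have h1 := congrArg (u ⬝ᵥ ·) (heq p)
        simp only [dotProduct_sub, dotProduct_smul, Matrix.dotProduct_mulVec,
          ← Matrix.mulVec_transpose, (G.isSymm_lapMatrix ℝ).eq, hu, smul_dotProduct,
          dotProduct_single_one, smul_eq_mul, sub_self] at h1
        linarith
      have hzero : ∀ j ≤ n, jump t r x (n - j) = 0 := by
        intro j
        induction j with
        | zero => simp [jump_self]
        | succ j ih =>
          intro hj
          have h1 := hpair ⟨n - (j + 1), by omega⟩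
          simp only [show n - (j + 1) + 1 = n - j by omega, ih (by omega), zero_mul] at h1
          refine (mul_eq_zero.1 h1).resolve_right fun h2 => hu0 ?_
          exact (hr _).eq_zero_of_apply_eq_zero hu h2
      intro p _ _
      have := hzero (n - (p + 1)) (by omega)
      rwa [Nat.sub_sub_self (by omega)] at this
    · intro p h0 hxr
      obtain ⟨y, c, hy, hyc⟩ := (hr p).exists_mulVec_sub_smul_eq (htr p) (ht p) μ
      -- The combination of `y` and the copy for which the multiples of `Pi.single (t p) 1` cancel
      -- is in the kernel of `L - μ`, hence zero.
      have hz : c • (fun w => x (p, w)) + jump t r x (p + 1) • y = 0 := by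
        by_contra hne
        refine hex ⟨_, hne, ?_⟩
        have h1 := heq p
        rw [h0, zero_smul, zero_sub] at h1
        rw [← sub_eq_zero]
        calc _ = c • (G.lapMatrix ℝ *ᵥ (fun w => x (p, w)) - μ • (fun w => x (p, w)))
              + jump t r x (p + 1) • (G.lapMatrix ℝ *ᵥ y - μ • y) := by
              rw [Matrix.mulVec_add, Matrix.mulVec_smul, Matrix.mulVec_smul]
              module
          _ = 0 := by
              rw [h1, hyc]
              module
      have h1 := congrFun hz (r p)
      simpa [hxr, hy] using h1
  have hall : ∀ j, ∀ hj : j < n, jump t r x j = 0 ∧ x (⟨j, hj⟩, r ⟨j, hj⟩) = 0 := by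
    intro j
    induction j with
    | zero => exact fun _ => ⟨jump_zero t r x, hx0⟩
    | succ j ih =>
      intro hj
      obtain ⟨h0, hxr⟩ := ih (by omega)
      have h1 := hjump ⟨j, by omega⟩ h0 hxr
      refine ⟨h1, ?_⟩
      have h2 := congrFun (hcopy ⟨j, by omega⟩ h0 h1 hxr) (t ⟨j, by omega⟩)
      simp only [Pi.zero_apply] at h2
      simpa [jump, hj, h2] using h1
  ext ⟨p, v⟩
  obtain ⟨h0, hxr⟩ := hall p p.2
  exact congrFun (hcopy p h0 (hjump p h0 hxr) hxr) v

end Chain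

/-! ### Simplicity of the eigenvalues -/

/-- If every eigenvector of a real symmetric matrix is nonzero at one fixed index, then the
eigenvalues are simple: a combination of two independent eigenvectors for the same eigenvalue
would vanish there. -/
theorem _root_.Matrix.IsHermitian.injective_eigenvalues {ι : Type*} [Fintype ι] [DecidableEq ι]
    {A : Matrix ι ι ℝ} (hA : A.IsHermitian) (a : ι)
    (h : ∀ (μ : ℝ) (x : ι → ℝ), A *ᵥ x = μ • x → x a = 0 → x = 0) :
    Function.Injective hA.eigenvalues := by
  intro i j hij
  by_contra hne
  set u := hA.eigenvectorBasis with hu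
  have hi := hA.mulVec_eigenvectorBasis i
  have hj := hA.mulVec_eigenvectorBasis j
  rw [← hij] at hj
  have hz : u j a • u i - u i a • u j = 0 := by
    have := h (hA.eigenvalues i) (u j a • ⇑(u i) - u i a • ⇑(u j)) ?_ ?_
    · ext b
      exact congrFun this b
    · rw [Matrix.mulVec_sub, Matrix.mulVec_smul, Matrix.mulVec_smul, hi, hj]
      module
    · simp [mul_comm]
  have h0 : u i a = 0 := by
    have h1 := congrArg (fun y => inner ℝ (u j) y) hz
    simpa [inner_sub_right, inner_smul_right, u.inner_eq_zero (Ne.symm hne)] using h1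
  have h2 : ⇑(u i) = (0 : ι → ℝ) := h _ _ hi h0
  refine u.orthonormal.ne_zero i ?_
  ext b
  exact congrFun h2 b

end AntiregularChain

open AntiregularChain in
theorem mainTheorem1 {n k : ℕ} (hn : 1 ≤ n)
    (G : SimpleGraph (Fin k)) [DecidableRel G.Adj] (hG : IsAntiregular G)
    (t r : Fin n → Fin k)
    (ht : ∀ p, IsTerminal G (t p)) (hr : ∀ p, IsDegreeRepeating G (r p))
    (htr : ∀ p, t p ≠ r p) :
    (chainGraph G t r).lapMatrix ℝ = chainLaplacian G t r ∧
    (∃ h : (chainLaplacian G t r).IsHermitian, Function.Injective h.eigenvalues) ∧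
    ∀ (μ : ℝ) (x : Fin n × Fin k → ℝ),
      Module.End.HasEigenvector (Matrix.toLin' (chainLaplacian G t r)) μ x →
      x (⟨0, hn⟩, r ⟨0, hn⟩) ≠ 0 := by
  have key (μ : ℝ) (x : Fin n × Fin k → ℝ) (hx : (chainLaplacian G t r).mulVec x = μ • x)
      (h0 : x (⟨0, hn⟩, r ⟨0, hn⟩) = 0) : x = 0 :=
    eq_zero_of_chainLaplacian_mulVec_eq (fun p => hG.degreesDistinctOff (hr p)) ht htr hn hx h0
  have hherm : (chainLaplacian G t r).IsHermitian :=
    lapMatrix_chainGraph G t r ▸ SimpleGraph.isHermitian_lapMatrix ℝ _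
  refine ⟨lapMatrix_chainGraph G t r, ⟨hherm, hherm.injective_eigenvalues _ key⟩, ?_⟩
  intro μ x hx h0
  exact hx.2 (key μ x (by simpa using hx.apply_eq_smul) h0)
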